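/- For a finite simple directed graph $G$ in which every node has at least one out-neighbour, a node $s$ and a teleport probability $\alpha\in(0,1)$, the personalized PageRank vector $\pi_s$ is the unique solution of $\pi_s^T=\alpha e_s^T+(1-\alpha)\pi_s^T W$, where $W=D^{-1}A$ is the random walk matrix of $G$ ($A$ the adjacency matrix, $D$ the diagonal matrix of out-degrees). Consider randomized algorithms that are given the number of nodes of $G$, the in- and out-degrees of all nodes, and two nodes $s,t$, and that can access the edges of $G$ only by adaptive queries: the $i$-th out-neighbour of a node, the $i$-th in-neighbour of a node (the adjacency lists being in arbitrary order), or whether a given ordered pair is an edge; each query counts as one edge access. Such an algorithm solves Detect-High$(\delta)$ with teleport probability $\alpha$ if, for every $G$ and every pair of nodes $(s,t)$, it accepts with probability $>9/10$ when $\pi_s(t)>\delta$ and rejects with probability $>9/10$ when $\pi_s(t)<\delta/2$; the probability is over the random choices of the algorithm only. Theorem. There are absolute constants $c,\delta_0>0$ such that for every $0<\delta<\delta_0$, every randomized algorithm that solves Detect-High$(\delta)$ with teleport probability $\alpha=\frac{1}{100\log(1/\delta)}$ makes, on some input $(G,s,t)$, at least $c/\sqrt{\delta}$ edge accesses in expectation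 (in particular, in the worst case over its random choices). -/

import Mathlib

open scoped Matrix ENNReal

/-- A finite simple directed graph on the nodes `0, …, n - 1`, given by adjacency lists: each node
carries a list of its out-neighbours and a list of its in-neighbours, in an arbitrary order.
Every node has an out-neighbour, so that the random walk on the graph is well defined. -/
structure ListDigraph (n : ℕ) where
  /-- the out-neighbours of a node -/
  outList : Fin n → List (Fin n)
  /-- the in-neighbours of a node -/
  inList : Fin n → List (Fin n)
  nodup_outList : ∀ v, (outList v).Nodup
  nodup_inList : ∀ v, (inList v).Nodup
  mem_inList_iff : ∀ u v, u ∈ inList v ↔ v ∈ outList u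
  loopless : ∀ v, v ∉ outList v
  outList_ne_nil : ∀ v, outList v ≠ []

namespace ListDigraph

variable {n : ℕ}

/-- The out-degree of a node. -/
def outDegree (G : ListDigraph n) (v : Fin n) : ℕ := (G.outList v).length

/-- The in-degree of a node. -/
def inDegree (G : ListDigraph n) (v : Fin n) : ℕ := (G.inList v).length

/-- The adjacency matrix `A`. -/
def adjMatrix (G : ListDigraph n) : Matrix (Fin n) (Fin n) ℝ :=
  Matrix.of fun u v => if v ∈ G.outList u then 1 else 0

/-- The random walk matrix `W = D⁻¹ A`, where `D` is the diagonal matrix of the out-degrees. -/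
noncomputable def walkMatrix (G : ListDigraph n) : Matrix (Fin n) (Fin n) ℝ :=
  Matrix.of fun u v => G.adjMatrix u v / (G.outDegree u : ℝ)

/-- `π` is the personalized PageRank vector of the node `s` with teleport probability `α`:
`πᵀ = α e_sᵀ + (1 - α) πᵀ W`. For `0 < α < 1` this linear system has exactly one solution. -/
def IsPersonalizedPageRank (G : ListDigraph n) (α : ℝ) (s : Fin n) (π : Fin n → ℝ) : Prop :=
  π = α • (Pi.single s 1 : Fin n → ℝ) + (1 - α) • (π ᵥ* G.walkMatrix)

end ListDigraph

/-- A deterministic adaptive algorithm on a hidden graph with nodes `0, …, n - 1`, as a decision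
tree. In each step it either stops and outputs a bit (`true` is ACCEPT, `false` is REJECT), or
makes one access to the edges of the graph and continues depending on the answer:
* `outNeighbor v i` asks for the `i`-th entry of the list of out-neighbours of `v`;
* `inNeighbor v i` asks for the `i`-th entry of the list of in-neighbours of `v`;
* `adjacent u v` asks whether there is an edge from `u` to `v`. -/
inductive QueryTree (n : ℕ) : Type where
  | output (b : Bool) : QueryTree n
  | outNeighbor (v : Fin n) (i : ℕ) (next : Option (Fin n) → QueryTree n) : QueryTree n
  | inNeighbor (v : Fin n) (i : ℕ) (next : Option (Fin n) → QueryTree n) : QueryTree n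
  | adjacent (u v : Fin n) (next : Bool → QueryTree n) : QueryTree n

namespace QueryTree

variable {n : ℕ}

/-- The output of the run on the graph `G`. -/
def run (G : ListDigraph n) : QueryTree n → Bool
  | output b => b
  | outNeighbor v i next => run G (next ((G.outList v)[i]?))
  | inNeighbor v i next => run G (next ((G.inList v)[i]?))
  | adjacent u v next => run G (next (decide (v ∈ G.outList u)))

/-- The number of edge accesses made in the run on the graph `G`. -/
def numAccesses (G : ListDigraph n) : QueryTree n → ℕ
  | output _ => 0
  | outNeighbor v i next => numAccesses G (next ((G.outList v)[i]?)) + 1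
  | inNeighbor v i next => numAccesses G (next ((G.inList v)[i]?)) + 1
  | adjacent u v next => numAccesses G (next (decide (v ∈ G.outList u))) + 1

end QueryTree

/-- A randomized algorithm for questions about a pair of nodes of a graph. It is told at no cost
the number `n` of nodes, the out-degrees and in-degrees of all nodes, and the pair `(s, t)`; with
this information it chooses a decision tree at random. -/
def RandomizedAlgorithm : Type :=
  (n : ℕ) → (outDeg inDeg : Fin n → ℕ) → (s t : Fin n) → PMF (QueryTree n)

namespace RandomizedAlgorithm

variable {n : ℕ}

/-- The random decision tree that is used on the input `(G, s, t)`. -/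
noncomputable def tree (A : RandomizedAlgorithm) (G : ListDigraph n) (s t : Fin n) :
    PMF (QueryTree n) :=
  A n G.outDegree G.inDegree s t

/-- The distribution of the output on the input `(G, s, t)`. -/
noncomputable def outputDist (A : RandomizedAlgorithm) (G : ListDigraph n) (s t : Fin n) :
    PMF Bool :=
  (A.tree G s t).map (QueryTree.run G)

/-- The expected number of edge accesses on the input `(G, s, t)`. -/
noncomputable def expectedAccesses (A : RandomizedAlgorithm) (G : ListDigraph n) (s t : Fin n) :
    ℝ≥0∞ :=
  ∑' T : QueryTree n, A.tree G s t T * (T.numAccesses G : ℝ≥0∞)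

/-- `A` solves Detect-High(`δ`) for personalized PageRank with teleport probability `α`: for every
graph and every pair `(s, t)` of its nodes, it accepts with probability `> 9/10` if `π_s(t) > δ`,
and it rejects with probability `> 9/10` if `π_s(t) < δ / 2`. -/
def SolvesDetectHigh (A : RandomizedAlgorithm) (α δ : ℝ) : Prop :=
  ∀ (n : ℕ) (G : ListDigraph n) (s t : Fin n) (π : Fin n → ℝ),
    G.IsPersonalizedPageRank α s π →
      (δ < π t → 9 / 10 < A.outputDist G s t true) ∧
      (π t < δ / 2 → 9 / 10 < A.outputDist G s t false)

end RandomizedAlgorithm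

/-! Two hubs each point to `N` leaves, one per index, and the leaves of each side lead into a trap
of that side. With `s` the hub of one side and `t` a sink of the other, `t` is unreachable from `s`.
Swapping the two hubs' edges at a single index `i` preserves all degrees, yet sends a `1/N` fraction
of the walk to the other side and makes `π_s(t)` about `1/(2N)`, which exceeds `δ` for `N ≈ 2/(5δ)`.
Every access reveals at most one switch, so a run on the unswitched graph separates it from at most
as many of the `N` variants as it makes accesses (`card_run_ne_le_numAccesses`). Correctness forces
each variant to be separated with probability at least `4/5` (`PMF.le_tsum_ne_of_lt_map`). Summing
over `i` gives `4N/5` expected accesses. This is of order `1/δ`, stronger than the required `1/√δ`.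
-/

/-! ### Hybrid argument for decision trees. -/

namespace QueryTree

variable {n : ℕ} {ι : Type*} [Fintype ι]

/-- If every single access distinguishes `G` from at most one member of the family `H`, then a run
on `G` distinguishes it from at most as many members as the run makes accesses. -/
theorem card_run_ne_le_numAccesses (G : ListDigraph n) (H : ι → ListDigraph n)
    (hout : ∀ (v : Fin n) (p : ℕ) (i j : ι), ((H i).outList v)[p]? ≠ (G.outList v)[p]? →
      ((H j).outList v)[p]? ≠ (G.outList v)[p]? → i = j)
    (hin : ∀ (v : Fin n) (p : ℕ) (i j : ι), ((H i).inList v)[p]? ≠ (G.inList v)[p]? →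
      ((H j).inList v)[p]? ≠ (G.inList v)[p]? → i = j)
    (hadj : ∀ (u v : Fin n) (i j : ι), ¬ (v ∈ (H i).outList u ↔ v ∈ G.outList u) →
      ¬ (v ∈ (H j).outList u ↔ v ∈ G.outList u) → i = j)
    (T : QueryTree n) :
    (Finset.univ.filter fun i => T.run (H i) ≠ T.run G).card ≤ T.numAccesses G := by
  classical
  have step : ∀ {β : Type} (ans : ListDigraph n → β) (next : β → QueryTree n)
      (_ : ∀ i j, ans (H i) ≠ ans G → ans (H j) ≠ ans G → i = j)
      (_ : (Finset.univ.filter fun i => (next (ans G)).run (H i) ≠ (next (ans G)).run G).card ≤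
        (next (ans G)).numAccesses G),
      (Finset.univ.filter fun i => (next (ans (H i))).run (H i) ≠ (next (ans G)).run G).card ≤
        (next (ans G)).numAccesses G + 1 := by
    intro β ans next hans ih
    have hsub : (Finset.univ.filter fun i =>
          (next (ans (H i))).run (H i) ≠ (next (ans G)).run G) ⊆
        (Finset.univ.filter fun i => (next (ans G)).run (H i) ≠ (next (ans G)).run G) ∪
          (Finset.univ.filter fun i => ans (H i) ≠ ans G) := by
      intro i
      simp only [Finset.mem_filter, Finset.mem_union, Finset.mem_univ, true_and]
      intro h
      -- With equal answers both runs enter the same subtree, where induction applies; the other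
      -- case costs at most one index.
      by_cases hi : ans (H i) = ans G
      · left
        rwa [hi] at h
      · exact Or.inr hi
    have hone : (Finset.univ.filter fun i => ans (H i) ≠ ans G).card ≤ 1 := by
      refine Finset.card_le_one.2 fun i hi j hj => ?_
      simp only [Finset.mem_filter, Finset.mem_univ, true_and] at hi hj
      exact hans i j hi hj
    exact (Finset.card_le_card hsub).trans ((Finset.card_union_le _ _).trans (by gcongr))
  induction T with
  | output b => simp [run]
  | outNeighbor v p next ih => exact step (fun K => (K.outList v)[p]?) next (hout v p) (ih _)
  | inNeighbor v p next ih => exact step (fun K => (K.inList v)[p]?) next (hin v p) (ih _)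
  | adjacent u v next ih =>
    refine step (fun K => decide (v ∈ K.outList u)) next (fun i j hi hj => ?_) (ih _)
    exact hadj u v i j (by simpa using hi) (by simpa using hj)

end QueryTree

/-! ### Comparing two outputs under the same random choices. -/

open scoped Classical in
theorem PMF.map_apply_eq_tsum_ite {α β : Type*} (P : PMF α) (f : α → β) (b : β) :
    P.map f b = ∑' a, P a * if f a = b then 1 else 0 := by
  rw [PMF.map_apply]
  refine tsum_congr fun a => ?_
  by_cases h : f a = b
  · simp [h]
  · simp [h, Ne.symm h]

/-- Two functions that are likely to have different values are likely to differ. -/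
theorem PMF.le_tsum_ne_of_lt_map {α : Type*} (P : PMF α) (f g : α → Bool)
    (hf : 9 / 10 < P.map f true) (hg : 9 / 10 < P.map g false) :
    (4 / 5 : ℝ≥0∞) ≤ ∑' a, P a * if f a ≠ g a then 1 else 0 := by
  have hle : P.map f true + P.map g false ≤ 1 + ∑' a, P a * if f a ≠ g a then 1 else 0 := by
    rw [PMF.map_apply_eq_tsum_ite, PMF.map_apply_eq_tsum_ite, ← P.tsum_coe, ← ENNReal.tsum_add,
      ← ENNReal.tsum_add]
    -- Pointwise, `f a = true` and `g a = false` can hold together only if `f a ≠ g a`.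
    refine ENNReal.tsum_le_tsum fun a => ?_
    cases f a <;> cases g a <;> simp
  have hsum : (9 / 10 + 9 / 10 : ℝ≥0∞) = 1 + 4 / 5 := by
    rw [← ENNReal.toReal_eq_toReal_iff' (by finiteness) (by finiteness),
      ENNReal.toReal_add (by finiteness) (by finiteness),
      ENNReal.toReal_add (by finiteness) (by finiteness)]
    norm_num
  have h := (add_le_add hf.le hg.le).trans hle
  rw [hsum] at h
  exact (ENNReal.add_le_add_iff_left ENNReal.one_ne_top).1 h

/-! ### The switch graph and the locality of its switches. -/

/-- The nodes of the switch graph: two hubs `hub c`, leaves `leaf i c`, and for each side `c` two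
sinks `sink c r`. -/
abbrev SwitchNode (N : ℕ) : Type := Bool ⊕ (Fin N × Bool) ⊕ (Bool × Bool)

namespace SwitchNode

variable {N : ℕ}

/-- A hub. -/
abbrev hub (c : Bool) : SwitchNode N := Sum.inl c

/-- A leaf. -/
abbrev leaf (i : Fin N) (c : Bool) : SwitchNode N := Sum.inr (Sum.inl (i, c))

/-- A sink. -/
abbrev sink (c r : Bool) : SwitchNode N := Sum.inr (Sum.inr (c, r))

/-- The out-neighbours in the switch graph: the hub `c` points to the leaf `i` of its own side, or
of the other side if `σ i` is set; the leaves point to the sink `sink c false` of their side, and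
the two sinks of a side point to each other. -/
def succs (σ : Fin N → Bool) : SwitchNode N → List (SwitchNode N)
  | Sum.inl c => (List.finRange N).map fun i => leaf i (c ^^ σ i)
  | Sum.inr (Sum.inl (_, c)) => [sink c false]
  | Sum.inr (Sum.inr (c, r)) => [sink c !r]

/-- The in-neighbours in the switch graph. -/
def preds (σ : Fin N → Bool) : SwitchNode N → List (SwitchNode N)
  | Sum.inl _ => []
  | Sum.inr (Sum.inl (i, c)) => [hub (c ^^ σ i)]
  | Sum.inr (Sum.inr (c, false)) => sink c true :: (List.finRange N).map fun i => leaf i c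
  | Sum.inr (Sum.inr (c, true)) => [sink c false]

theorem nodup_succs (σ : Fin N → Bool) (v : SwitchNode N) : (succs σ v).Nodup := by
  rcases v with c | ⟨i, c⟩ | ⟨c, r⟩
  · exact (List.nodup_finRange N).map fun i j h => congrArg Prod.fst (Sum.inl.inj (Sum.inr.inj h))
  · simp [succs]
  · simp [succs]

theorem nodup_preds (σ : Fin N → Bool) (v : SwitchNode N) : (preds σ v).Nodup := by
  rcases v with c | ⟨i, c⟩ | ⟨c, _ | _⟩
  · simp [preds]
  · simp [preds]
  · simp only [preds, List.nodup_cons]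
    exact ⟨by simp, (List.nodup_finRange N).map fun i j h =>
      congrArg Prod.fst (Sum.inl.inj (Sum.inr.inj h))⟩
  · simp [preds]

theorem mem_preds_iff (σ : Fin N → Bool) (u v : SwitchNode N) :
    u ∈ preds σ v ↔ v ∈ succs σ u := by
  rcases u with d | ⟨j, d⟩ | ⟨d, q⟩ <;> rcases v with c | ⟨i, c⟩ | ⟨c, _ | _⟩ <;>
    simp [preds, succs]
  · cases c <;> cases d <;> cases σ i <;> simp
  · exact fun _ => eq_comm
  · exact fun _ => eq_comm

theorem notMem_succs (σ : Fin N → Bool) (v : SwitchNode N) : v ∉ succs σ v := by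
  rcases v with c | ⟨i, c⟩ | ⟨c, r⟩ <;> simp [succs]

theorem succs_ne_nil [NeZero N] (σ : Fin N → Bool) (v : SwitchNode N) : succs σ v ≠ [] := by
  rcases v with c | ⟨i, c⟩ | ⟨c, r⟩ <;> simp [succs, NeZero.ne N]

theorem length_succs (σ τ : Fin N → Bool) (v : SwitchNode N) :
    (succs σ v).length = (succs τ v).length := by
  rcases v with c | ⟨i, c⟩ | ⟨c, r⟩ <;> simp [succs]

theorem length_preds (σ τ : Fin N → Bool) (v : SwitchNode N) :
    (preds σ v).length = (preds τ v).length := by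
  rcases v with c | ⟨i, c⟩ | ⟨c, _ | _⟩ <;> simp [preds]

/-- An entry of a list of out-neighbours depends on at most one of the switches. -/
theorem eq_of_getElem?_succs_ne {σ : Fin N → Bool} {τ : Fin N → Fin N → Bool}
    (hτ : ∀ i j, i ≠ j → τ i j = σ j) (v : SwitchNode N) (p : ℕ) (i j : Fin N)
    (hi : (succs (τ i) v)[p]? ≠ (succs σ v)[p]?) (hj : (succs (τ j) v)[p]? ≠ (succs σ v)[p]?) :
    i = j := by
  rcases v with c | ⟨k, c⟩ | ⟨c, r⟩
  · by_cases hp : p < N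
    · have key : ∀ l : Fin N,
          (succs (τ l) (hub c))[p]? ≠ (succs σ (hub c))[p]? → l = ⟨p, hp⟩ := by
        intro l hl
        by_contra hne
        exact hl (by simp [succs, hp, hτ l _ hne])
      rw [key i hi, key j hj]
    · exact absurd (by simp [succs, hp]) hi
  · exact absurd rfl hi
  · exact absurd rfl hi

/-- An entry of a list of in-neighbours depends on at most one of the switches. -/
theorem eq_of_getElem?_preds_ne {σ : Fin N → Bool} {τ : Fin N → Fin N → Bool}
    (hτ : ∀ i j, i ≠ j → τ i j = σ j) (v : SwitchNode N) (p : ℕ) (i j : Fin N)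
    (hi : (preds (τ i) v)[p]? ≠ (preds σ v)[p]?) (hj : (preds (τ j) v)[p]? ≠ (preds σ v)[p]?) :
    i = j := by
  rcases v with c | ⟨k, c⟩ | ⟨c, _ | _⟩
  · exact absurd rfl hi
  · have key : ∀ l : Fin N,
        (preds (τ l) (leaf k c))[p]? ≠ (preds σ (leaf k c))[p]? → l = k := by
      intro l hl
      by_contra hne
      exact hl (by simp [preds, hτ l _ hne])
    rw [key i hi, key j hj]
  · exact absurd rfl hi
  · exact absurd rfl hi

/-- The presence of an edge depends on at most one of the switches. -/
theorem eq_of_mem_succs_ne {σ : Fin N → Bool} {τ : Fin N → Fin N → Bool}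
    (hτ : ∀ i j, i ≠ j → τ i j = σ j) (u v : SwitchNode N) (i j : Fin N)
    (hi : ¬ (v ∈ succs (τ i) u ↔ v ∈ succs σ u)) (hj : ¬ (v ∈ succs (τ j) u ↔ v ∈ succs σ u)) :
    i = j := by
  -- Seen from the head of the edge, only a leaf's list varies, and it depends on that leaf's switch
  -- alone.
  simp only [← mem_preds_iff] at hi hj
  rcases v with c | ⟨k, c⟩ | ⟨c, _ | _⟩
  · exact absurd Iff.rfl hi
  · have key : ∀ l : Fin N,
        ¬ (u ∈ preds (τ l) (leaf k c) ↔ u ∈ preds σ (leaf k c)) → l = k := by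
      intro l hl
      by_contra hne
      exact hl (by simp [preds, hτ l _ hne])
    rw [key i hi, key j hj]
  · exact absurd Iff.rfl hi
  · exact absurd Iff.rfl hi

/-! ### PageRank on the switch graph. -/

/-- The personalized PageRank of the leaves for the start node `hub false`. -/
noncomputable def leafRank (α : ℝ) (σ : Fin N → Bool) (i : Fin N) (c : Bool) : ℝ :=
  (1 - α) * ((if c ^^ σ i then 0 else α) / N)

/-- The personalized PageRank for the start node `hub false`. -/
noncomputable def rank (α : ℝ) (σ : Fin N → Bool) : SwitchNode N → ℝ
  | Sum.inl c => if c then 0 else α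
  | Sum.inr (Sum.inl (i, c)) => leafRank α σ i c
  | Sum.inr (Sum.inr (c, false)) =>
      (1 - α) * (∑ i, leafRank α σ i c) / (1 - (1 - α) ^ 2)
  | Sum.inr (Sum.inr (c, true)) =>
      (1 - α) * ((1 - α) * (∑ i, leafRank α σ i c) / (1 - (1 - α) ^ 2))

/-- Without switches no path leads from `hub false` to the side `true`. -/
theorem rank_sink_of_eq_false (α : ℝ) :
    rank α (fun _ : Fin N => false) (sink true false) = 0 := by
  simp [rank, leafRank]

/-- A numbering of the nodes. -/
noncomputable def number (N : ℕ) : SwitchNode N ≃ Fin (Fintype.card (SwitchNode N)) :=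
  Fintype.equivFin _

end SwitchNode

open SwitchNode

/-- The switch graph on the nodes `0, …, n - 1`. -/
noncomputable def switchGraph {N : ℕ} [NeZero N] (σ : Fin N → Bool) :
    ListDigraph (Fintype.card (SwitchNode N)) where
  outList v := (succs σ ((number N).symm v)).map (number N)
  inList v := (preds σ ((number N).symm v)).map (number N)
  nodup_outList v := (nodup_succs σ _).map (number N).injective
  nodup_inList v := (nodup_preds σ _).map (number N).injective
  mem_inList_iff u v := by
    have h : ∀ (a : Fin (Fintype.card (SwitchNode N))) (l : List (SwitchNode N)),
        a ∈ l.map (number N) ↔ (number N).symm a ∈ l := fun a l => by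
      simp [← Equiv.eq_symm_apply]
    rw [h, h, mem_preds_iff]
  loopless v := by
    simpa [← Equiv.eq_symm_apply] using notMem_succs σ ((number N).symm v)
  outList_ne_nil v := by simpa using succs_ne_nil σ _

namespace SwitchNode

variable {N : ℕ} [NeZero N]

theorem mem_outList_switchGraph (σ : Fin N → Bool) (u v : Fin (Fintype.card (SwitchNode N))) :
    v ∈ (switchGraph σ).outList u ↔ (number N).symm v ∈ succs σ ((number N).symm u) := by
  simp [switchGraph, ← Equiv.eq_symm_apply]

theorem outDegree_switchGraph (σ : Fin N → Bool) (v : Fin (Fintype.card (SwitchNode N))) :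
    (switchGraph σ).outDegree v = (succs σ ((number N).symm v)).length := by
  simp [switchGraph, ListDigraph.outDegree]

/-- The algorithm knows the degrees for free, so they must not betray the switches. -/
theorem outDegree_switchGraph_eq (σ τ : Fin N → Bool) :
    (switchGraph σ).outDegree = (switchGraph τ).outDegree := by
  ext v
  simpa [switchGraph, ListDigraph.outDegree] using length_succs σ τ _

theorem inDegree_switchGraph_eq (σ τ : Fin N → Bool) :
    (switchGraph σ).inDegree = (switchGraph τ).inDegree := by
  ext v
  simpa [switchGraph, ListDigraph.inDegree] using length_preds σ τ _

-- Checking the linear system suffices: `SolvesDetectHigh` applies to any solution, so uniqueness is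
-- not needed.
open scoped Classical in
theorem isPersonalizedPageRank_rank {α : ℝ} (h0 : 0 < α) (h1 : α < 1) (σ : Fin N → Bool) :
    (switchGraph σ).IsPersonalizedPageRank α (number N (hub false))
      (rank α σ ∘ (number N).symm) := by
  have hne : 1 - (1 - α) ^ 2 ≠ 0 := by nlinarith
  funext v
  obtain ⟨w, rfl⟩ := (number N).surjective v
  have hsum : ((rank α σ ∘ (number N).symm) ᵥ* (switchGraph σ).walkMatrix) (number N w) =
      ∑ u, rank α σ u * ((if w ∈ succs σ u then 1 else 0) / ((succs σ u).length : ℝ)) := by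
    rw [Matrix.vecMul, dotProduct, ← (number N).sum_comp]
    refine Finset.sum_congr rfl fun u _ => ?_
    simp [ListDigraph.walkMatrix, ListDigraph.adjMatrix, mem_outList_switchGraph,
      outDegree_switchGraph]
  have hsingle : (Pi.single (number N (hub false)) 1 : _ → ℝ) (number N w) =
      if w = hub false then 1 else 0 := by
    simp [Pi.single_apply]
  simp only [Pi.add_apply, Pi.smul_apply, smul_eq_mul, hsum, hsingle, Function.comp_apply,
    Equiv.symm_apply_apply, Fintype.sum_sum_type, Fintype.sum_prod_type, Fintype.sum_bool]
  rcases w with c | ⟨i, c⟩ | ⟨c, _ | _⟩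
  · cases c <;> simp [succs, rank]
  · cases c <;> cases h : σ i <;> simp [succs, rank, leafRank, h, div_eq_mul_inv]
  · cases c <;> simp [succs, rank] <;> field_simp <;> ring
  · cases c <;> simp [succs, rank]

/-- The switched leaf has rank `(1 - α) α / N`. One more step and the returns around the 2-cycle of
sinks multiply this by `(1 - α) / (1 - (1 - α)^2)`, whose denominator is `α (2 - α)`, so the factor
`α` cancels. -/
theorem rank_sink_single {α : ℝ} (h0 : 0 < α) (h1 : α < 1) (i : Fin N) :
    rank α (fun j => decide (j = i)) (sink true false) = (1 - α) ^ 2 / (N * (2 - α)) := by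
  have hN : (N : ℝ) ≠ 0 := NeZero.ne _
  have hne : 1 - (1 - α) ^ 2 ≠ 0 := by nlinarith
  have hne' : 2 - α ≠ 0 := by linarith
  have hsum : ∑ j, leafRank α (fun j => decide (j = i)) j true = (1 - α) * (α / N) := by
    rw [Finset.sum_eq_single i]
    · simp [leafRank]
    · intro j _ hj
      simp [leafRank, hj]
    · simp
  simp only [rank, hsum]
  field_simp
  ring

end SwitchNode

/-! ### The lower bound in terms of `N`. -/

namespace RandomizedAlgorithm

variable {N : ℕ} [NeZero N]

/-- On the graph without switches, an algorithm makes about as many accesses as there are places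
for a switch, provided that a single switch creates a large personalized PageRank. -/
theorem SolvesDetectHigh.le_expectedAccesses {A : RandomizedAlgorithm} {α δ : ℝ}
    (hA : A.SolvesDetectHigh α δ) (h0 : 0 < α) (h1 : α < 1) (hδ : 0 < δ)
    (hN : δ < (1 - α) ^ 2 / (N * (2 - α))) :
    (N : ℝ≥0∞) * (4 / 5) ≤ A.expectedAccesses (switchGraph fun _ : Fin N => false)
      (number N (hub false)) (number N (sink true false)) := by
  set s := number N (hub false)
  set t := number N (sink true false)
  set G := switchGraph fun _ : Fin N => false
  set H : Fin N → ListDigraph _ := fun i => switchGraph fun j => decide (j = i)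
  -- Equal degrees give one distribution of trees, so all runs can be compared on the same random
  -- tree.
  have htree : ∀ i, A.tree (H i) s t = A.tree G s t := fun i => by
    rw [tree, tree, outDegree_switchGraph_eq _ fun _ => false,
      inDegree_switchGraph_eq _ fun _ => false]
  have hG : 9 / 10 < (A.tree G s t).map (QueryTree.run G) false := by
    refine (hA _ G s t _ (isPersonalizedPageRank_rank h0 h1 _)).2 ?_
    simpa [t, rank_sink_of_eq_false] using hδ
  have hH : ∀ i, 9 / 10 < (A.tree G s t).map (QueryTree.run (H i)) true := fun i => by
    rw [← htree i]
    refine (hA _ (H i) s t _ (isPersonalizedPageRank_rank h0 h1 _)).1 ?_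
    simpa [t, rank_sink_single h0 h1] using hN
  have hτ : ∀ i j : Fin N, i ≠ j → decide (j = i) = false := fun i j h => by
    simpa using h.symm
  have hcard : ∀ T : QueryTree _,
      (Finset.univ.filter fun i => T.run (H i) ≠ T.run G).card ≤ T.numAccesses G := by
    refine QueryTree.card_run_ne_le_numAccesses G H ?_ ?_ ?_
    · intro v p i j hi hj
      refine eq_of_getElem?_succs_ne hτ ((number N).symm v) p i j (fun h => hi ?_) fun h => hj ?_ <;>
        simp only [G, H, switchGraph, List.getElem?_map, h]
    · intro v p i j hi hj
      refine eq_of_getElem?_preds_ne hτ ((number N).symm v) p i j (fun h => hi ?_) fun h => hj ?_ <;>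
        simp only [G, H, switchGraph, List.getElem?_map, h]
    · intro u v i j hi hj
      simp only [G, H, mem_outList_switchGraph] at hi hj
      exact eq_of_mem_succs_ne hτ _ _ i j hi hj
  calc (N : ℝ≥0∞) * (4 / 5) = ∑ _i : Fin N, (4 / 5 : ℝ≥0∞) := by simp
    _ ≤ ∑ i, ∑' T, A.tree G s t T * if T.run (H i) ≠ T.run G then 1 else 0 :=
        Finset.sum_le_sum fun i _ => PMF.le_tsum_ne_of_lt_map _ _ _ (hH i) hG
    _ = ∑' T, ∑ i, A.tree G s t T * if T.run (H i) ≠ T.run G then 1 else 0 :=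
        (Summable.tsum_finsetSum fun _ _ => ENNReal.summable).symm
    _ ≤ A.expectedAccesses G s t := by
        refine ENNReal.tsum_le_tsum fun T => ?_
        rw [← Finset.mul_sum, Finset.sum_boole]
        gcongr
        exact hcard T

end RandomizedAlgorithm

/-! ### Choice of the constants. -/

/-- Every algorithm for Detect-High(`δ`) with `α = 1 / (100 log (1 / δ))` makes `Ω(1 / √δ)` edge
accesses, even in expectation, on some input. -/
theorem theorem4 :
    ∃ c : ℝ, 0 < c ∧ ∃ δ₀ : ℝ, 0 < δ₀ ∧ ∀ δ : ℝ, 0 < δ → δ < δ₀ →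
      ∀ A : RandomizedAlgorithm, A.SolvesDetectHigh (1 / (100 * Real.log (1 / δ))) δ →
        ∃ (n : ℕ) (G : ListDigraph n) (s t : Fin n),
          ENNReal.ofReal (c / Real.sqrt δ) ≤ A.expectedAccesses G s t := by
  refine ⟨1 / 10, by norm_num, 1 / 10, by norm_num, fun δ hδ hδ' A hA => ?_⟩
  have hlog : 1 < Real.log (1 / δ) := by
    rw [Real.lt_log_iff_exp_lt (by positivity), lt_div_iff₀ hδ]
    nlinarith [Real.exp_one_lt_d9, Real.exp_pos 1]
  set α := 1 / (100 * Real.log (1 / δ)) with hα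
  have h0 : 0 < α := by positivity
  have h1 : α < 1 / 100 := by
    rw [hα, div_lt_div_iff₀ (by positivity) (by norm_num)]
    linarith
  -- Any constant below about `1/2` would do: `N δ (2 - α) ≤ 4/5`, while `(1 - α)^2 > 0.98`.
  set N := ⌊2 / 5 / δ⌋₊
  have hle : (N : ℝ) ≤ 2 / 5 / δ := Nat.floor_le (by positivity)
  have hlt : 2 / 5 / δ < N + 1 := Nat.lt_floor_add_one _
  have hmul : (N : ℝ) * δ ≤ 2 / 5 := (le_div_iff₀ hδ).1 hle
  have hmul' : 2 / 5 < (N + 1 : ℝ) * δ := (div_lt_iff₀ hδ).1 hlt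
  have hpos : (0 : ℝ) < N := by nlinarith
  have : NeZero N := ⟨by exact_mod_cast hpos.ne'⟩
  have hN : δ < (1 - α) ^ 2 / (N * (2 - α)) := by
    rw [lt_div_iff₀ (mul_pos hpos (by linarith))]
    nlinarith [mul_pos hpos hδ]
  refine ⟨_, _, _, _, le_trans ?_ (hA.le_expectedAccesses (N := N) h0 (by linarith) hδ hN)⟩
  have hreal : 1 / 10 / √δ ≤ N * (4 / 5) := by
    -- Here the bound of order `1/δ` is weakened to `1/√δ`.
    have hsqrt : δ ≤ √δ := Real.le_sqrt_of_sq_le (by nlinarith)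
    calc 1 / 10 / √δ ≤ 1 / 10 / δ := by gcongr
      _ ≤ N * (4 / 5) := by
        rw [div_le_iff₀ hδ]
        nlinarith
  calc ENNReal.ofReal (1 / 10 / √δ) ≤ ENNReal.ofReal (N * (4 / 5)) :=
        ENNReal.ofReal_le_ofReal hreal
    _ = N * (4 / 5) := by
        rw [ENNReal.ofReal_mul (by positivity), ENNReal.ofReal_natCast,
          ENNReal.ofReal_div_of_pos (by norm_num)]
        norm_num
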